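/- Throughout, $q$ denotes a prime power, $\mathbb{F}_q \subset \mathbb{F}_{q^2}$ are finite fields with $q$ and $q^2$ elements, and $\mathrm{Her}_n(q^2)$ is the $\mathbb{F}_q$-vector space of Hermitian matrices in $\mathbb{F}_{q^2}^{n\times n}$, i.e. those $M$ with $M_{ij}=M_{ji}^{\,q}$ for all $i,j$. A $k$-dimensional Hermitian code is an $\mathbb{F}_q$-subspace $\mathcal{C}\le \mathrm{Her}_n(q^2)$ with $\dim_{\mathbb{F}_q}\mathcal{C}=k$; the minimum distance of a non-zero code $\mathcal{C}$ is the least rank (over $\mathbb{F}_{q^2}$) of a non-zero matrix in $\mathcal{C}$. Let $\delta^{\mathrm{Her}}_q(n\times n,k,d)$ be the proportion, among all $k$-dimensional Hermitian codes in $\mathrm{Her}_n(q^2)$, of those with minimum distance at least $d$. A non-zero Hermitian code $\mathcal{C}$ of minimum distance $d'$ is called Hermitian MRD if $\dim_{\mathbb{F}_q}\mathcal{C}=n(n-d'+1)$. All limits and $O$-estimates are for $q\to+\infty$ over the prime powers, with $n,k,d$ fixed. **Theorem.** Let $2\le d\le n$ be integers. 1. Let $1\le k\le n(n-d+1)$ be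 an integer. Then $$\delta^{\mathrm{Her}}_q(n\times n,k,d)\in O\left(q^{\,n^2-k+1-(d-1)(2n-d+1)}\right)\quad\text{as } q\to+\infty,$$ and $$\lim_{q\to+\infty}\delta^{\mathrm{Her}}_q(n\times n,k,d)=\begin{cases}1 & \text{if } k<n^2+1-(d-1)(2n-d+1),\\ 0 & \text{if } k>n^2+1-(d-1)(2n-d+1).\end{cases}$$ 2. In particular, $$\delta^{\mathrm{Her}}_q(n\times n,n(n-d+1),d)\in O\left(q^{-(d-1)(n-d+1)+1}\right)\quad\text{as } q\to+\infty,$$ and if $n\ge 3$, then Hermitian MRD codes are sparse: the proportion of Hermitian MRD codes among all Hermitian codes in $\mathrm{Her}_n(q^2)$ of dimension $n(n-d+1)$ tends to $0$ as $q\to+\infty$. -/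

import Mathlib

open Filter Asymptotics Topology

section HermitianCodes

variable (K L : Type*) [Field K] [Fintype K] [Field L] [Algebra K L] (n : ℕ)

/-- The conjugate transpose `M*` of a square matrix over `L`: transpose `M` and apply the
conjugation `x ↦ x ^ q`, where `q = |K|`, to every entry. -/
def hermConjTranspose (M : Matrix (Fin n) (Fin n) L) : Matrix (Fin n) (Fin n) L :=
  Matrix.of fun i j => M j i ^ Fintype.card K

/-- The `K`-space of Hermitian `n × n` matrices over `L`, that is of matrices with `M = M*`. -/
def hermitianSpace : Submodule K (Matrix (Fin n) (Fin n) L) where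
  carrier := {M | M = hermConjTranspose K L n M}
  zero_mem' := by
    ext i j
    simp [hermConjTranspose]
  add_mem' := by
    intro A B hA hB
    ext i j
    have h1 := congrFun (congrFun hA i) j
    have h2 := congrFun (congrFun hB i) j
    have h3 := map_add (FiniteField.frobeniusAlgHom K L) (A j i) (B j i)
    simp only [hermConjTranspose, Matrix.of_apply, Matrix.add_apply,
      FiniteField.coe_frobeniusAlgHom] at h1 h2 h3 ⊢
    rw [h3, ← h1, ← h2]
  smul_mem' := by
    intro c A hA
    ext i j
    have h1 := congrFun (congrFun hA i) j
    have h3 := map_smul (FiniteField.frobeniusAlgHom K L) c (A j i)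
    simp only [hermConjTranspose, Matrix.of_apply, Matrix.smul_apply,
      FiniteField.coe_frobeniusAlgHom] at h1 h3 ⊢
    rw [h3, ← h1]

variable {K L n}

/-- The minimum (rank) distance of a non-zero code: the least rank of a non-zero codeword. -/
noncomputable def rankMinDistance (C : Submodule K (Matrix (Fin n) (Fin n) L)) : ℕ :=
  sInf {r | ∃ M ∈ C, M ≠ 0 ∧ M.rank = r}

variable (K L n)

/-- The set of `k`-dimensional Hermitian codes: `K`-linear subspaces, of dimension `k` over `K`,
of the space of Hermitian `n × n` matrices over `L`. -/
def hermitianCodes (k : ℕ) : Set (Submodule K (Matrix (Fin n) (Fin n) L)) :=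
  {C | C ≤ hermitianSpace K L n ∧ Module.finrank K C = k}

/-- The density function of Hermitian codes: the proportion, within the `k`-dimensional Hermitian
codes, of those whose minimum distance is at least `d`. -/
noncomputable def hermitianDensity (k d : ℕ) : ℝ :=
  ({C ∈ hermitianCodes K L n k | d ≤ rankMinDistance C}.ncard : ℝ) /
    ((hermitianCodes K L n k).ncard : ℝ)

variable {K L n}

/-- A (non-zero) Hermitian code is Hermitian MRD if its dimension over `K` equals
`n (n - d + 1)`, where `d` is its minimum distance. -/
def IsHermitianMRD (C : Submodule K (Matrix (Fin n) (Fin n) L)) : Prop :=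
  C ≤ hermitianSpace K L n ∧ C ≠ ⊥ ∧
    Module.finrank K C = n * (n - rankMinDistance C + 1)

variable (K L n)

/-- The proportion, within the Hermitian codes of dimension `n (n - d + 1)`, of the Hermitian MRD
codes (such codes have minimum distance `d`). -/
noncomputable def hermitianMRDDensity (d : ℕ) : ℝ :=
  ({C ∈ hermitianCodes K L n (n * (n - d + 1)) | IsHermitianMRD C}.ncard : ℝ) /
    ((hermitianCodes K L n (n * (n - d + 1))).ncard : ℝ)

end HermitianCodes

/-! Put r = d - 1, s = n - r, E = r^2 + 2rs = (d-1)(2n-d+1) and N = n^2, the dimension of the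
Hermitian space. A code has minimum distance at least d exactly when it avoids the set B of non-zero
Hermitian matrices of rank at most r, and B has about q^E elements up to constants depending on n
and d. For a uniformly random k-dimensional subspace, a non-zero vector is contained with
probability p = (q^k-1)/(q^N-1), so the number X of elements of B in it has mean μ = |B|p.
Independent vectors are not positively correlated, and a vector has at most q multiples, so Var X ≤
qμ. Chebyshev gives P(X = 0) ≤ q/μ (`ncard_submodule_disjoint_div_le`). Since B is stable under
non-zero scalars, X > 0 forces X ≥ q - 1, and Markov gives P(X > 0) ≤ μ/(q-1)
(`one_sub_ncard_submodule_disjoint_div_le`). These bounds have orders q^(N-k+1-E) and its inverse.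
The size of B comes from writing a Hermitian matrix of rank at most r as T S T*, where T is an
identity block stacked on a free s × r block, up to a permutation of indices. -/

/-! ### Subspaces containing a given independent family. -/

section SubspaceCounting

open Finset Module

variable {K V : Type*} [Field K] [AddCommGroup V] [Module K V]

/-- The general linear group is transitive on linearly independent families of given length. -/
theorem LinearIndependent.exists_linearEquiv_apply_eq [FiniteDimensional K V] {ι : Type*}
    {s s' : ι → V} (hs : LinearIndependent K s) (hs' : LinearIndependent K s') :
    ∃ g : V ≃ₗ[K] V, ∀ i, g (s i) = s' i := by
  -- The coordinate isomorphism between the two spans extends to an automorphism of `V`.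
  obtain ⟨g, hg⟩ := Submodule.exists_linearEquiv_restrict_eq
    (hs.linearCombinationEquiv.symm ≪≫ₗ hs'.linearCombinationEquiv)
  refine ⟨g, fun i => ?_⟩
  have h1 : hs.linearCombinationEquiv (Finsupp.single i 1) = s i := by simp
  have h2 : hs'.linearCombinationEquiv (Finsupp.single i 1) = s' i := by simp
  rw [← h1, ← hg, ← h2]
  simp

/-- The number of `k`-dimensional subspaces containing a linearly independent family depends only
on the length of the family. -/
theorem ncard_submodule_mem_eq [FiniteDimensional K V] {ι : Type*} {s s' : ι → V}
    (hs : LinearIndependent K s) (hs' : LinearIndependent K s') (k : ℕ) :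
    {C : Submodule K V | finrank K C = k ∧ ∀ i, s i ∈ C}.ncard =
      {C : Submodule K V | finrank K C = k ∧ ∀ i, s' i ∈ C}.ncard := by
  obtain ⟨g, hg⟩ := hs.exists_linearEquiv_apply_eq hs'
  have h : {C : Submodule K V | finrank K C = k ∧ ∀ i, s' i ∈ C} =
      Submodule.orderIsoMapComap g '' {C : Submodule K V | finrank K C = k ∧ ∀ i, s i ∈ C} := by
    rw [OrderIso.image_eq_preimage_symm]
    ext C
    simp only [Set.mem_ofPred_eq, Set.mem_preimage, Submodule.orderIsoMapComap_symm_apply,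
      Submodule.mem_comap, LinearEquiv.coe_coe, hg]
    rw [Submodule.comap_equiv_eq_map_symm, LinearEquiv.finrank_map_eq]
  rw [h, Set.ncard_image_of_injective _ (OrderIso.injective _)]

variable [Fintype K] [Finite V]

theorem natCard_linearIndependent_mem (C : Submodule K V) (t : ℕ) :
    Nat.card {s : Fin t → V // LinearIndependent K s ∧ ∀ i, s i ∈ C} =
      ∏ i : Fin t, (Fintype.card K ^ finrank K C - Fintype.card K ^ i.val) := by
  have e : {s : Fin t → V // LinearIndependent K s ∧ ∀ i, s i ∈ C} ≃
      {s : Fin t → C // LinearIndependent K s} :=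
    { toFun := fun s => ⟨fun i => ⟨s.1 i, s.2.2 i⟩,
        LinearIndependent.of_comp C.subtype (by exact s.2.1)⟩
      invFun := fun s => ⟨fun i => s.1 i, s.2.map' C.subtype C.ker_subtype, fun i => (s.1 i).2⟩
      left_inv := fun s => rfl
      right_inv := fun s => rfl }
  rw [Nat.card_congr e]
  rcases le_or_gt t (finrank K C) with h | h
  · exact card_linearIndependent h
  -- Families longer than the dimension: none is independent, and the factor of index `finrank K C`
  -- is zero.
  · rw [Finset.prod_eq_zero (Finset.mem_univ (⟨finrank K C, h⟩ : Fin t)) (by simp), Nat.card_eq_zero]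
    left
    refine ⟨fun s => ?_⟩
    have := s.2.fintype_card_le_finrank
    simp at this
    omega

/-- Double counting of the pairs `(s, C)`, where `s` is a linearly independent family in the
`k`-dimensional subspace `C`. -/
theorem ncard_submodule_mem_mul {t : ℕ} {s : Fin t → V} (hs : LinearIndependent K s) (k : ℕ) :
    {C : Submodule K V | finrank K C = k ∧ ∀ i, s i ∈ C}.ncard *
        ∏ i : Fin t, (Fintype.card K ^ finrank K V - Fintype.card K ^ i.val) =
      {C : Submodule K V | finrank K C = k}.ncard *
        ∏ i : Fin t, (Fintype.card K ^ k - Fintype.card K ^ i.val) := by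
  classical
  have := Fintype.ofFinite V
  have := Fintype.ofFinite (Submodule K V)
  have key := sum_card_bipartiteAbove_eq_sum_card_bipartiteBelow
    (s := univ.filter fun s' : Fin t → V => LinearIndependent K s')
    (t := univ.filter fun C : Submodule K V => finrank K C = k)
    (fun s' C => ∀ i, s' i ∈ C)
  -- Both inner counts are constant: over a family by transitivity of the linear group, over a
  -- subspace by `natCard_linearIndependent_mem`.
  rw [Finset.sum_congr rfl (g := fun _ =>
    {C : Submodule K V | finrank K C = k ∧ ∀ i, s i ∈ C}.ncard),
    Finset.sum_congr (s₁ := univ.filter fun C : Submodule K V => finrank K C = k) rfl (g := fun _ =>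
      ∏ i : Fin t, (Fintype.card K ^ k - Fintype.card K ^ i.val)), sum_const, sum_const,
      smul_eq_mul, smul_eq_mul] at key
  · rw [mul_comm, Set.ncard_eq_toFinset_card' {C : Submodule K V | finrank K C = k},
      Set.toFinset_ofPred, ← key]
    have h := natCard_linearIndependent_mem (⊤ : Submodule K V) t
    simp only [Submodule.mem_top, implies_true, and_true, finrank_top] at h
    rw [← h, Nat.card_eq_fintype_card, Fintype.card_subtype]
  · intro C hC
    rw [← (mem_filter.1 hC).2, ← natCard_linearIndependent_mem, Nat.card_eq_fintype_card,
      Fintype.card_subtype, bipartiteBelow, filter_filter]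
  · intro s' hs'
    rw [ncard_submodule_mem_eq hs (mem_filter.1 hs').2, Set.ncard_eq_toFinset_card',
      Set.toFinset_ofPred, bipartiteAbove, filter_filter]

end SubspaceCounting

/-! ### First and second moments of the number of vectors of `B` in a random subspace. -/

section SubspaceMoments

open Finset Module

variable {K V : Type*} [Field K] [AddCommGroup V] [Module K V] [Fintype K] [Finite V]

theorem ncard_submodule_singleton_mem {v : V} (hv : v ≠ 0) (k : ℕ) (hV : 1 ≤ finrank K V) :
    ({C : Submodule K V | finrank K C = k ∧ v ∈ C}.ncard : ℝ) =
      {C : Submodule K V | finrank K C = k}.ncard *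
        (((Fintype.card K : ℝ) ^ k - 1) / ((Fintype.card K : ℝ) ^ finrank K V - 1)) := by
  have hq : 1 < (Fintype.card K : ℝ) := by exact_mod_cast Fintype.one_lt_card
  have hN : 1 < (Fintype.card K : ℝ) ^ finrank K V := one_lt_pow₀ hq (by omega)
  have h := ncard_submodule_mem_mul (K := K) (s := ![v]) (by simpa using hv) k
  simp only [Fin.forall_fin_one, Matrix.cons_val_fin_one, Fin.prod_univ_one, Fin.val_zero,
    pow_zero] at h
  have h' := congrArg (Nat.cast (R := ℝ)) h
  push_cast [Nat.cast_sub (Nat.one_le_pow _ _ Fintype.card_pos)] at h'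
  rw [← mul_div_assoc, eq_div_iff (by linarith), h']

/-- The exact probability is p(q^k-q)/(q^N-q), and the second factor is at most p because k ≤ N. -/
theorem ncard_submodule_pair_mem_le {v w : V} (hvw : LinearIndependent K ![v, w]) {k : ℕ}
    (hk : 1 ≤ k) (hkV : k ≤ finrank K V) (hV : 2 ≤ finrank K V) :
    ({C : Submodule K V | finrank K C = k ∧ v ∈ C ∧ w ∈ C}.ncard : ℝ) ≤
      {C : Submodule K V | finrank K C = k}.ncard *
        (((Fintype.card K : ℝ) ^ k - 1) / ((Fintype.card K : ℝ) ^ finrank K V - 1)) ^ 2 := by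
  have hq : 1 < (Fintype.card K : ℝ) := by exact_mod_cast Fintype.one_lt_card
  have hN : (Fintype.card K : ℝ) < (Fintype.card K : ℝ) ^ finrank K V := by
    simpa using pow_lt_pow_right₀ hq (show 1 < finrank K V by omega)
  have hkN : (Fintype.card K : ℝ) ^ k ≤ (Fintype.card K : ℝ) ^ finrank K V :=
    pow_le_pow_right₀ hq.le hkV
  have hk1 : 1 ≤ (Fintype.card K : ℝ) ^ k := one_le_pow₀ hq.le
  have h := ncard_submodule_mem_mul (K := K) hvw k
  simp only [Fin.forall_fin_two, Matrix.cons_val_zero, Matrix.cons_val_one, Fin.prod_univ_two,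
    Fin.val_zero, Fin.val_one, pow_zero, pow_one] at h
  have h' := congrArg (Nat.cast (R := ℝ)) h
  push_cast [Nat.cast_sub (Nat.one_le_pow _ _ Fintype.card_pos),
    Nat.cast_sub (show Fintype.card K ≤ Fintype.card K ^ k from Nat.le_self_pow (by omega) _),
    Nat.cast_sub (show Fintype.card K ≤ Fintype.card K ^ finrank K V from
      Nat.le_self_pow (by omega) _)] at h'
  set q := (Fintype.card K : ℝ)
  set G := ({C : Submodule K V | finrank K C = k}.ncard : ℝ)
  have hG : 0 ≤ G := Nat.cast_nonneg _
  have h2 : ({C : Submodule K V | finrank K C = k ∧ v ∈ C ∧ w ∈ C}.ncard : ℝ) =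
      G * ((q ^ k - 1) / (q ^ finrank K V - 1) * ((q ^ k - q) / (q ^ finrank K V - q))) := by
    have : q ^ finrank K V - 1 ≠ 0 := by linarith
    have : q ^ finrank K V - q ≠ 0 := by linarith
    field_simp
    linarith
  rw [h2, sq]
  refine mul_le_mul_of_nonneg_left (mul_le_mul_of_nonneg_left ?_
    (div_nonneg (by linarith) (by linarith))) hG
  rw [div_le_div_iff₀ (by linarith) (by linarith)]
  -- The difference of the two sides is (q-1)(q^N-q^k).
  nlinarith [mul_le_mul_of_nonneg_right hkN (sub_nonneg.2 hq.le)]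

omit [Finite V] in
open Classical in
theorem card_filter_not_linearIndependent_le {v : V} (hv : v ≠ 0) (B : Finset V) :
    #{w ∈ B | ¬ LinearIndependent K ![v, w]} ≤ Fintype.card K := by
  rw [← Finset.card_univ]
  refine (card_le_card (t := univ.image fun a : K => a • v) ?_).trans card_image_le
  intro w hw
  have := (mem_filter.1 hw).2
  rw [LinearIndependent.pair_iff' hv] at this
  push Not at this
  simpa using this

omit [Fintype K] in
theorem ncard_submodule_finrank_pos {k : ℕ} (hkV : k ≤ finrank K V) :
    0 < {C : Submodule K V | finrank K C = k}.ncard := by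
  rw [Set.ncard_pos]
  obtain ⟨s, hs⟩ := exists_linearIndependent_of_le_finrank hkV
  exact ⟨Submodule.span K (Set.range s), by simpa using finrank_span_eq_card hs⟩

variable (B : Finset V)

open Classical in
theorem sum_card_filter_mem_submodule [Fintype (Submodule K V)] (hB : 0 ∉ B) (k : ℕ)
    (hV : 1 ≤ finrank K V) :
    ∑ C ∈ univ.filter (fun C : Submodule K V => finrank K C = k), (#{v ∈ B | v ∈ C} : ℝ) =
      #B * ({C : Submodule K V | finrank K C = k}.ncard *
        (((Fintype.card K : ℝ) ^ k - 1) / ((Fintype.card K : ℝ) ^ finrank K V - 1))) := by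
  have key := sum_card_bipartiteAbove_eq_sum_card_bipartiteBelow (s := B)
    (t := univ.filter fun C : Submodule K V => finrank K C = k) (fun v C => v ∈ C)
  have key' := congrArg (Nat.cast (R := ℝ)) key
  push_cast at key'
  simp only [bipartiteBelow] at key'
  rw [← key', ← nsmul_eq_mul, ← sum_const]
  refine sum_congr rfl fun v hv => ?_
  rw [← ncard_submodule_singleton_mem (fun h => hB (h ▸ hv)) k hV, Set.ncard_eq_toFinset_card',
    Set.toFinset_ofPred, bipartiteAbove, filter_filter]

-- The square counts pairs in `B`. For fixed v, at most q vectors w are dependent on v, each costing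
-- at most p; the others cost at most p^2.
open Classical in
theorem sum_card_filter_mem_submodule_sq_le [Fintype (Submodule K V)] (hB : 0 ∉ B) {k : ℕ}
    (hk : 1 ≤ k) (hkV : k ≤ finrank K V) (hV : 2 ≤ finrank K V) :
    ∑ C ∈ univ.filter (fun C : Submodule K V => finrank K C = k), (#{v ∈ B | v ∈ C} : ℝ) ^ 2 ≤
      {C : Submodule K V | finrank K C = k}.ncard * (Fintype.card K * (#B *
        (((Fintype.card K : ℝ) ^ k - 1) / ((Fintype.card K : ℝ) ^ finrank K V - 1))) + (#B *
        (((Fintype.card K : ℝ) ^ k - 1) / ((Fintype.card K : ℝ) ^ finrank K V - 1))) ^ 2) := by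
  have hp : 0 ≤ ((Fintype.card K : ℝ) ^ k - 1) / ((Fintype.card K : ℝ) ^ finrank K V - 1) := by
    have hq : 1 ≤ (Fintype.card K : ℝ) := by exact_mod_cast Fintype.card_pos
    exact div_nonneg (sub_nonneg.2 (one_le_pow₀ hq)) (sub_nonneg.2 (one_le_pow₀ hq))
  have key := sum_card_bipartiteAbove_eq_sum_card_bipartiteBelow (s := B ×ˢ B)
    (t := univ.filter fun C : Submodule K V => finrank K C = k) (fun v C => v.1 ∈ C ∧ v.2 ∈ C)
  have key' := congrArg (Nat.cast (R := ℝ)) key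
  push_cast at key'
  have h1 : ∀ C : Submodule K V, (#{v ∈ B | v ∈ C} : ℝ) ^ 2 =
      #(bipartiteBelow (fun (v : V × V) (C : Submodule K V) => v.1 ∈ C ∧ v.2 ∈ C) (B ×ˢ B) C) := by
    intro C
    rw [bipartiteBelow, filter_product (fun v => v ∈ C) (fun v => v ∈ C), card_product]
    push_cast
    ring
  simp only [h1]
  rw [← key', sum_product]
  set G := ({C : Submodule K V | finrank K C = k}.ncard : ℝ) with hG
  set p := ((Fintype.card K : ℝ) ^ k - 1) / ((Fintype.card K : ℝ) ^ finrank K V - 1) with hp_def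
  have hG0 : 0 ≤ G := Nat.cast_nonneg _
  have h2 : ∀ v w : V, (#(bipartiteAbove (fun (v : V × V) (C : Submodule K V) => v.1 ∈ C ∧ v.2 ∈ C)
      (univ.filter fun C : Submodule K V => finrank K C = k) (v, w)) : ℝ) =
      {C : Submodule K V | finrank K C = k ∧ v ∈ C ∧ w ∈ C}.ncard := by
    intro v w
    rw [Set.ncard_eq_toFinset_card', Set.toFinset_ofPred, bipartiteAbove, filter_filter]
  simp only [h2]
  have h3 : ∀ v ∈ B, ∑ w ∈ B,
      ({C : Submodule K V | finrank K C = k ∧ v ∈ C ∧ w ∈ C}.ncard : ℝ) ≤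
      Fintype.card K * (G * p) + #B * (G * p ^ 2) := by
    intro v hv
    have hv0 : v ≠ 0 := fun h => hB (h ▸ hv)
    rw [← sum_filter_not_add_sum_filter B (fun w => LinearIndependent K ![v, w])]
    refine add_le_add ?_ ?_
    · refine (sum_le_card_nsmul _ _ (G * p) fun w _ => ?_).trans ?_
      · rw [hG, hp_def, ← ncard_submodule_singleton_mem hv0 k (by omega)]
        exact Nat.cast_le.2 (Set.ncard_le_ncard fun C hC => ⟨hC.1, hC.2.1⟩)
      · rw [nsmul_eq_mul]
        gcongr
        exact card_filter_not_linearIndependent_le hv0 B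
    · refine (sum_le_card_nsmul _ _ (G * p ^ 2) fun w hw => ?_).trans ?_
      · exact ncard_submodule_pair_mem_le (mem_filter.1 hw).2 hk hkV hV
      · rw [nsmul_eq_mul]
        gcongr
        exact filter_subset _ _
  refine (sum_le_card_nsmul _ _ _ h3).trans (le_of_eq ?_)
  rw [nsmul_eq_mul]
  ring

/-- Second moment bound: if `B` is large, few subspaces avoid `B`. -/
theorem ncard_submodule_disjoint_div_le (hB : 0 ∉ B) (hB0 : B.Nonempty) {k : ℕ}
    (hk : 1 ≤ k) (hkV : k ≤ finrank K V) (hV : 2 ≤ finrank K V) :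
    ({C : Submodule K V | finrank K C = k ∧ ∀ v ∈ B, v ∉ C}.ncard : ℝ) /
      {C : Submodule K V | finrank K C = k}.ncard ≤
      Fintype.card K / (#B *
        (((Fintype.card K : ℝ) ^ k - 1) / ((Fintype.card K : ℝ) ^ finrank K V - 1))) := by
  classical
  have := Fintype.ofFinite (Submodule K V)
  have hq : 1 < (Fintype.card K : ℝ) := by exact_mod_cast Fintype.one_lt_card
  have h1 := sum_card_filter_mem_submodule (K := K) B hB k (by omega)
  have h2 := sum_card_filter_mem_submodule_sq_le (K := K) B hB hk hkV hV
  have hp : 0 < ((Fintype.card K : ℝ) ^ k - 1) / ((Fintype.card K : ℝ) ^ finrank K V - 1) :=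
    div_pos (sub_pos.2 (one_lt_pow₀ hq (by omega))) (sub_pos.2 (one_lt_pow₀ hq (by omega)))
  have hG0 : (0 : ℝ) < {C : Submodule K V | finrank K C = k}.ncard := by
    exact_mod_cast ncard_submodule_finrank_pos hkV
  have hGc : ({C : Submodule K V | finrank K C = k}.ncard : ℝ) =
      #(univ.filter fun C : Submodule K V => finrank K C = k) := by
    rw [Set.ncard_eq_toFinset_card', Set.toFinset_ofPred]
  set G := ({C : Submodule K V | finrank K C = k}.ncard : ℝ)
  set p := ((Fintype.card K : ℝ) ^ k - 1) / ((Fintype.card K : ℝ) ^ finrank K V - 1)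
  have hB1 : (0 : ℝ) < #B := by exact_mod_cast hB0.card_pos
  set μ := #B * p with hμ
  have hμ0 : 0 < μ := mul_pos hB1 hp
  -- Chebyshev: each subspace avoiding `B` contributes μ^2 to the sum of squared deviations.
  have h3 : ({C : Submodule K V | finrank K C = k ∧ ∀ v ∈ B, v ∉ C}.ncard : ℝ) * μ ^ 2 ≤
      ∑ C ∈ univ.filter (fun C : Submodule K V => finrank K C = k), ((#{v ∈ B | v ∈ C} : ℝ) - μ) ^ 2 := by
    rw [Set.ncard_eq_toFinset_card', Set.toFinset_ofPred, ← nsmul_eq_mul, ← filter_filter]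
    refine le_trans (le_of_eq ?_) (sum_le_sum_of_subset_of_nonneg (filter_subset
      (fun C : Submodule K V => ∀ v ∈ B, v ∉ C) _) fun C _ _ => sq_nonneg _)
    rw [← sum_const]
    refine sum_congr rfl fun C hC => ?_
    rw [filter_false_of_mem (mem_filter.1 hC).2]
    simp
  have h4 : ∑ C ∈ univ.filter (fun C : Submodule K V => finrank K C = k),
        ((#{v ∈ B | v ∈ C} : ℝ) - μ) ^ 2 ≤
      Fintype.card K * μ * G := by
    have : ∀ C : Submodule K V, ((#{v ∈ B | v ∈ C} : ℝ) - μ) ^ 2 =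
        (#{v ∈ B | v ∈ C} : ℝ) ^ 2 - 2 * μ * #{v ∈ B | v ∈ C} + μ ^ 2 := fun C => by ring
    simp only [this]
    rw [sum_add_distrib, sum_sub_distrib, ← mul_sum, h1, sum_const, nsmul_eq_mul, ← hGc]
    have : (#B : ℝ) * (G * p) = G * μ := by rw [hμ]; ring
    rw [this]
    nlinarith
  rw [div_le_div_iff₀ hG0 hμ0]
  have h5 := h3.trans h4
  refine le_of_mul_le_mul_right ?_ hμ0
  linarith

/-- First moment bound: if the cone `B` is small, few subspaces meet `B`. -/
theorem one_sub_ncard_submodule_disjoint_div_le (hB : 0 ∉ B)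
    (hsmul : ∀ a : K, a ≠ 0 → ∀ v ∈ B, a • v ∈ B) {k : ℕ} (hkV : k ≤ finrank K V)
    (hV : 1 ≤ finrank K V) :
    1 - ({C : Submodule K V | finrank K C = k ∧ ∀ v ∈ B, v ∉ C}.ncard : ℝ) /
      {C : Submodule K V | finrank K C = k}.ncard ≤
      #B * (((Fintype.card K : ℝ) ^ k - 1) / ((Fintype.card K : ℝ) ^ finrank K V - 1)) /
        (Fintype.card K - 1) := by
  classical
  have := Fintype.ofFinite (Submodule K V)
  have hq : 1 < (Fintype.card K : ℝ) := by exact_mod_cast Fintype.one_lt_card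
  have h1 := sum_card_filter_mem_submodule (K := K) B hB k hV
  have hG0 : (0 : ℝ) < {C : Submodule K V | finrank K C = k}.ncard := by
    exact_mod_cast ncard_submodule_finrank_pos hkV
  have hGc : ({C : Submodule K V | finrank K C = k}.ncard : ℝ) =
      #(univ.filter fun C : Submodule K V => finrank K C = k) := by
    rw [Set.ncard_eq_toFinset_card', Set.toFinset_ofPred]
  set G := ({C : Submodule K V | finrank K C = k}.ncard : ℝ)
  set p := ((Fintype.card K : ℝ) ^ k - 1) / ((Fintype.card K : ℝ) ^ finrank K V - 1)
  -- A subspace meeting `B` contains the q - 1 non-zero multiples of a common vector, all in `B`.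
  have h2 : (G - {C : Submodule K V | finrank K C = k ∧ ∀ v ∈ B, v ∉ C}.ncard) *
      (Fintype.card K - 1) ≤
      ∑ C ∈ univ.filter (fun C : Submodule K V => finrank K C = k), (#{v ∈ B | v ∈ C} : ℝ) := by
    rw [Set.ncard_eq_toFinset_card', Set.toFinset_ofPred, ← filter_filter, hGc,
      ← card_filter_add_card_filter_not (s := univ.filter fun C : Submodule K V => finrank K C = k)
        (fun C : Submodule K V => ∀ v ∈ B, v ∉ C)]
    push_cast
    rw [add_sub_cancel_left, ← nsmul_eq_mul]
    refine le_trans ?_ (sum_le_sum_of_subset_of_nonneg (filter_subset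
      (fun C : Submodule K V => ¬ ∀ v ∈ B, v ∉ C) _) fun C _ _ => Nat.cast_nonneg _)
    refine card_nsmul_le_sum _ _ _ fun C hC => ?_
    have hC := (mem_filter.1 hC).2
    push Not at hC
    obtain ⟨v, hvB, hvC⟩ := hC
    have hv0 : v ≠ 0 := fun h => hB (h ▸ hvB)
    rw [← Nat.cast_one, ← Nat.cast_sub Fintype.card_pos, Nat.cast_le, ← Finset.card_univ,
      ← card_erase_of_mem (mem_univ (0 : K))]
    refine card_le_card_of_injOn (fun a => a • v) (fun a ha => ?_)
      ((smul_left_injective K hv0).injOn)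
    have ha0 : a ≠ 0 := (mem_erase.1 ha).1
    simpa using ⟨hsmul a ha0 v hvB, C.smul_mem a hvC⟩
  rw [h1] at h2
  rw [le_div_iff₀ (by linarith), one_sub_div hG0.ne', div_mul_eq_mul_div, div_le_iff₀ hG0]
  linarith

end SubspaceMoments

/-! ### Counting Hermitian matrices of bounded rank over a field with involution. -/

section HermitianCounting

open Matrix

variable {L : Type*} [Field L] [StarRing L]

/-- Reindexing Hermitian matrices. -/
def isHermitianReindex {ι κ : Type*} (e : ι ≃ κ) :
    {M : Matrix ι ι L // M.IsHermitian} ≃ {M : Matrix κ κ L // M.IsHermitian} :=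
  (Matrix.reindex e e).subtypeEquiv fun _ => (isHermitian_reindex_iff e).symm

/-- The blocks of a Hermitian matrix. -/
def isHermitianFromBlocks (ι κ : Type*) :
    {M : Matrix ι ι L // M.IsHermitian} × Matrix ι κ L × {M : Matrix κ κ L // M.IsHermitian} ≃
      {M : Matrix (ι ⊕ κ) (ι ⊕ κ) L // M.IsHermitian} where
  toFun x := ⟨fromBlocks x.1.1 x.2.1 x.2.1ᴴ x.2.2.1, x.1.2.fromBlocks rfl x.2.2.2⟩
  invFun M := (⟨M.1.toBlocks₁₁, M.2.submatrix Sum.inl⟩, M.1.toBlocks₁₂,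
    ⟨M.1.toBlocks₂₂, M.2.submatrix Sum.inr⟩)
  left_inv x := by simp
  right_inv M := by
    have h : M.1.toBlocks₁₂ᴴ = M.1.toBlocks₂₁ := by
      ext i j
      exact M.2.apply _ _
    ext1
    simp [h, fromBlocks_toBlocks]

/-- Bordering by one row and column adds n free entries of `L` and one diagonal entry fixed by
`star`, a factor q^(2n+1). -/
theorem natCard_isHermitian_fin {q : ℕ} (hfix : Nat.card {x : L // star x = x} = q)
    (hL : Nat.card L = q ^ 2) (n : ℕ) :
    Nat.card {M : Matrix (Fin n) (Fin n) L // M.IsHermitian} = q ^ n ^ 2 := by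
  induction n with
  | zero =>
    have : Unique {M : Matrix (Fin 0) (Fin 0) L // M.IsHermitian} :=
      ⟨⟨⟨0, isHermitian_zero⟩⟩, fun M => Subtype.ext (Subsingleton.elim _ _)⟩
    simp
  | succ n ih =>
    have e : {M : Matrix (Fin 1) (Fin 1) L // M.IsHermitian} ≃ {x : L // star x = x} :=
      { toFun := fun M => ⟨M.1 0 0, M.2.apply 0 0⟩
        invFun := fun x => ⟨Matrix.of fun _ _ => x.1, IsHermitian.ext fun _ _ => x.2⟩
        left_inv := fun M => by
          ext i j
          simp [Subsingleton.elim i 0, Subsingleton.elim j 0]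
        right_inv := fun x => rfl }
    have h : Nat.card (Matrix (Fin n) (Fin 1) L) = (q ^ 2) ^ n := by
      simp [Matrix, Nat.card_fun, hL]
    rw [← Nat.card_congr (isHermitianReindex finSumFinEquiv),
      ← Nat.card_congr (isHermitianFromBlocks (Fin n) (Fin 1)), Nat.card_prod, Nat.card_prod, ih,
      Nat.card_congr e, hfix, h]
    ring

/-- The Hermitian matrix with the given top left block `S` and row space spanned by the top rows,
where the bottom rows are obtained from the top ones through `B`. -/
def hermitianOfTopRows {r s : ℕ} (S : Matrix (Fin r) (Fin r) L) (B : Matrix (Fin s) (Fin r) L) :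
    Matrix (Fin r ⊕ Fin s) (Fin r ⊕ Fin s) L :=
  fromRows 1 B * S * (fromRows 1 B)ᴴ

theorem isHermitian_hermitianOfTopRows {r s : ℕ} {S : Matrix (Fin r) (Fin r) L}
    (hS : S.IsHermitian) (B : Matrix (Fin s) (Fin r) L) : (hermitianOfTopRows S B).IsHermitian :=
  isHermitian_mul_mul_conjTranspose _ hS

theorem rank_hermitianOfTopRows_le {r s : ℕ} (S : Matrix (Fin r) (Fin r) L)
    (B : Matrix (Fin s) (Fin r) L) : (hermitianOfTopRows S B).rank ≤ r := by
  rw [hermitianOfTopRows, Matrix.mul_assoc]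
  exact (rank_mul_le_left _ _).trans ((rank_le_card_width _).trans (by simp))

/-- The left blocks are S and BS, so an invertible S lets B be recovered. -/
theorem hermitianOfTopRows_injective {r s : ℕ} {S S' : Matrix (Fin r) (Fin r) L}
    {B B' : Matrix (Fin s) (Fin r) L} (hS : IsUnit S)
    (h : hermitianOfTopRows S B = hermitianOfTopRows S' B') : S = S' ∧ B = B' := by
  have h1 : ∀ (S : Matrix (Fin r) (Fin r) L) (B : Matrix (Fin s) (Fin r) L),
      hermitianOfTopRows S B = fromBlocks S (S * Bᴴ) (B * S) (B * S * Bᴴ) := by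
    intro S B
    rw [hermitianOfTopRows, conjTranspose_fromRows_eq_fromCols_conjTranspose, fromRows_mul,
      fromRows_mul_fromCols]
    simp
  rw [h1, h1, fromBlocks_inj] at h
  obtain ⟨rfl, -, h, -⟩ := h
  rw [isUnit_iff_isUnit_det] at hS
  have h2 := congrArg (· * S⁻¹) h
  simp only [mul_nonsing_inv_cancel_right S _ hS] at h2
  exact ⟨rfl, h2⟩

/-- Every Hermitian matrix of rank at most `r` arises from its principal block on `r` rows
which span the row space. -/
theorem Matrix.IsHermitian.exists_eq_hermitianOfTopRows {r s : ℕ}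
    {M : Matrix (Fin (r + s)) (Fin (r + s)) L} (hM : M.IsHermitian) (hr : M.rank ≤ r) :
    ∃ (e : Fin r ⊕ Fin s ≃ Fin (r + s)) (S : Matrix (Fin r) (Fin r) L) (B : Matrix (Fin s) (Fin r) L),
      S.IsHermitian ∧ M = (hermitianOfTopRows S B).submatrix e.symm e.symm := by
  classical
  obtain ⟨κ, a, ha, hspan, hli⟩ := exists_linearIndependent' L M.row
  have : Finite κ := Finite.of_injective a ha
  have := Fintype.ofFinite κ
  have hκ : Fintype.card κ ≤ r := by
    rw [rank_eq_finrank_span_row, ← hspan, finrank_span_eq_card hli] at hr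
    exact hr
  -- A row basis may have fewer than r members; it is enlarged to exactly r indices.
  obtain ⟨J, hJ, -, hJr⟩ := Finset.exists_subsuperset_card_eq
    (Finset.subset_univ (Finset.univ.image a)) (n := r)
    (by rw [Finset.card_image_of_injective _ ha]; exact hκ) (by simp)
  let e : Fin r ⊕ Fin s ≃ Fin (r + s) := finSumEquivOfFinset hJr (by simp [Finset.card_compl, hJr])
  let M' := M.submatrix e e
  have hM' : M'.IsHermitian := hM.submatrix e
  have hrows : ∀ i, ∃ c : Fin r → L, ∑ j, c j • M (e (Sum.inl j)) = M i := by
    intro i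
    rw [← Submodule.mem_span_range_iff_exists_fun]
    have h1 : M i ∈ Submodule.span L (Set.range (M.row ∘ a)) := by
      rw [hspan]
      exact Submodule.subset_span ⟨i, rfl⟩
    refine Submodule.span_mono ?_ h1
    rintro _ ⟨k, rfl⟩
    have hk : a k ∈ J := hJ (Finset.mem_image_of_mem _ (Finset.mem_univ k))
    refine ⟨(J.orderIsoOfFin hJr).symm ⟨a k, hk⟩, ?_⟩
    have h2 : e (Sum.inl ((J.orderIsoOfFin hJr).symm ⟨a k, hk⟩)) = a k := by
      rw [finSumEquivOfFinset_inl, ← Finset.coe_orderIsoOfFin_apply, OrderIso.apply_symm_apply]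
    simp only [h2]
    rfl
  choose c hc using hrows
  let B : Matrix (Fin s) (Fin r) L := Matrix.of fun i => c (e (Sum.inr i))
  have h1 : M' = fromRows 1 B * M'.toRows₁ := by
    rw [fromRows_mul, Matrix.one_mul]
    ext i j
    rcases i with i | i
    · rfl
    · simp only [fromRows_apply_inr, Matrix.mul_apply]
      have := congrFun (hc (e (Sum.inr i))) (e j)
      simpa [M', B] using this.symm
  -- Conjugate-transposing `h1` and keeping the top rows expresses these rows through the principal
  -- block.
  have h2 : M'.toRows₁ = M'.toBlocks₁₁ * (fromRows 1 B)ᴴ := by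
    have h3 := congrArg (fun A => Aᴴ) h1
    beta_reduce at h3
    rw [hM'.eq, conjTranspose_mul] at h3
    have h4 : M'.toRows₁ᴴ = fromRows M'.toBlocks₁₁ M'.toBlocks₂₁ := by
      ext i j
      rcases i with i | i <;> exact hM'.apply _ _
    rw [h4, fromRows_mul] at h3
    exact (congrArg toRows₁ h3).trans (toRows₁_fromRows _ _)
  refine ⟨e, M'.toBlocks₁₁, B, hM'.submatrix Sum.inl, ?_⟩
  rw [hermitianOfTopRows, Matrix.mul_assoc, ← h2, ← h1]
  simp [M']

section Bounds

variable [Finite L] {q : ℕ} (hfix : Nat.card {x : L // star x = x} = q) (hL : Nat.card L = q ^ 2)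
include hfix hL

theorem natCard_isHermitian_rank_le_le (r s : ℕ) :
    Nat.card {M : Matrix (Fin (r + s)) (Fin (r + s)) L // M.IsHermitian ∧ M.rank ≤ r} ≤
      (r + s).factorial * q ^ (r ^ 2 + 2 * r * s) := by
  let f : (Fin r ⊕ Fin s ≃ Fin (r + s)) × {S : Matrix (Fin r) (Fin r) L // S.IsHermitian} ×
      Matrix (Fin s) (Fin r) L →
      {M : Matrix (Fin (r + s)) (Fin (r + s)) L // M.IsHermitian ∧ M.rank ≤ r} := fun x =>
    ⟨(hermitianOfTopRows x.2.1.1 x.2.2).submatrix x.1.symm x.1.symm,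
      (isHermitian_hermitianOfTopRows x.2.1.2 _).submatrix _,
      (rank_submatrix_le _ _ _).trans (rank_hermitianOfTopRows_le _ _)⟩
  have hf : Function.Surjective f := by
    rintro ⟨M, hM, hr⟩
    obtain ⟨e, S, B, hS, h⟩ := hM.exists_eq_hermitianOfTopRows hr
    exact ⟨⟨e, ⟨S, hS⟩, B⟩, Subtype.ext h.symm⟩
  refine (Nat.card_le_card_of_surjective f hf).trans (le_of_eq ?_)
  rw [Nat.card_prod, Nat.card_prod, natCard_isHermitian_fin hfix hL]
  have h1 : Nat.card (Matrix (Fin s) (Fin r) L) = ((q ^ 2) ^ r) ^ s := by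
    simp [Matrix, Nat.card_fun, hL]
  have h2 : Nat.card (Fin r ⊕ Fin s ≃ Fin (r + s)) = (r + s).factorial := by
    rw [Nat.card_eq_fintype_card, Fintype.card_equiv finSumFinEquiv]
    simp
  rw [h1, h2]
  ring

/-- Singular matrices have rank at most r, so the preceding bound with s = 1 applies; its exponent
is one less than (r+1)^2. -/
theorem le_natCard_isHermitian_isUnit (r : ℕ) :
    q ^ (r + 1) ^ 2 ≤ Nat.card {S : Matrix (Fin (r + 1)) (Fin (r + 1)) L //
      S.IsHermitian ∧ IsUnit S} + (r + 1).factorial * q ^ (r ^ 2 + 2 * r) := by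
  rw [← natCard_isHermitian_fin hfix hL]
  have h := natCard_isHermitian_rank_le_le hfix hL r 1
  rw [mul_one] at h
  refine le_trans ?_ (Nat.add_le_add_left h _)
  rw [← Nat.card_sum]
  classical
  let f : {M : Matrix (Fin (r + 1)) (Fin (r + 1)) L // M.IsHermitian} →
      {S : Matrix (Fin (r + 1)) (Fin (r + 1)) L // S.IsHermitian ∧ IsUnit S} ⊕
      {M : Matrix (Fin (r + 1)) (Fin (r + 1)) L // M.IsHermitian ∧ M.rank ≤ r} := fun M =>
    if h : IsUnit M.1 then Sum.inl ⟨M.1, M.2, h⟩ else Sum.inr ⟨M.1, M.2, by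
      by_contra hr
      rw [rank_eq_finrank_span_row, not_le] at hr
      exact h (linearIndependent_rows_iff_isUnit.1
        (linearIndependent_iff_card_le_finrank_span.2 (by rw [Fintype.card_fin]; exact hr)))⟩
  refine Nat.card_le_card_of_injective f fun M M' h => ?_
  simp only [f] at h
  split_ifs at h <;> simpa [Subtype.ext_iff] using h

-- Keeping the pivot rows on top and S invertible makes the parametrisation injective.
omit hfix in
theorem le_natCard_isHermitian_rank_le (r s : ℕ) :
    Nat.card {S : Matrix (Fin r) (Fin r) L // S.IsHermitian ∧ IsUnit S} * q ^ (2 * r * s) ≤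
      Nat.card {M : Matrix (Fin (r + s)) (Fin (r + s)) L // M.IsHermitian ∧ M.rank ≤ r} := by
  let f : {S : Matrix (Fin r) (Fin r) L // S.IsHermitian ∧ IsUnit S} × Matrix (Fin s) (Fin r) L →
      {M : Matrix (Fin (r + s)) (Fin (r + s)) L // M.IsHermitian ∧ M.rank ≤ r} := fun x =>
    ⟨(hermitianOfTopRows x.1.1 x.2).submatrix finSumFinEquiv.symm finSumFinEquiv.symm,
      (isHermitian_hermitianOfTopRows x.1.2.1 _).submatrix _,
      (rank_submatrix_le _ _ _).trans (rank_hermitianOfTopRows_le _ _)⟩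
  have hf : Function.Injective f := by
    rintro ⟨⟨S, hS⟩, B⟩ ⟨⟨S', hS'⟩, B'⟩ h
    have h1 : hermitianOfTopRows S B = hermitianOfTopRows S' B' :=
      (Matrix.reindex finSumFinEquiv finSumFinEquiv).injective (congrArg Subtype.val h)
    obtain ⟨rfl, rfl⟩ := hermitianOfTopRows_injective hS.2 h1
    rfl
  refine le_trans (le_of_eq ?_) (Nat.card_le_card_of_injective f hf)
  have h1 : Nat.card (Matrix (Fin s) (Fin r) L) = ((q ^ 2) ^ r) ^ s := by
    simp [Matrix, Nat.card_fun, hL]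
  rw [Nat.card_prod, h1]
  ring

end Bounds

end HermitianCounting

/-! ### Minimum distance of non-zero codes. -/

section RankMinDistance

variable {K L : Type*} [Field K] [Field L] [Algebra K L] {n : ℕ}

/-- For the zero code the infimum is over the empty set and takes the default value 0, hence `hC`.
-/
theorem le_rankMinDistance_iff {C : Submodule K (Matrix (Fin n) (Fin n) L)} (hC : C ≠ ⊥) {d : ℕ} :
    d ≤ rankMinDistance C ↔ ∀ M ∈ C, M ≠ 0 → d ≤ M.rank := by
  obtain ⟨M₀, hM₀, h0⟩ := C.exists_mem_ne_zero_of_ne_bot hC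
  constructor
  · intro h M hM hM0
    exact h.trans (Nat.sInf_le ⟨M, hM, hM0, rfl⟩)
  · intro h
    refine le_csInf ⟨_, M₀, hM₀, h0, rfl⟩ ?_
    rintro _ ⟨M, hM, hM0, rfl⟩
    exact h M hM hM0

theorem rankMinDistance_le {C : Submodule K (Matrix (Fin n) (Fin n) L)} (hC : C ≠ ⊥) :
    rankMinDistance C ≤ n := by
  obtain ⟨M₀, hM₀, h0⟩ := C.exists_mem_ne_zero_of_ne_bot hC
  exact ((le_rankMinDistance_iff hC).1 le_rfl M₀ hM₀ h0).trans (Matrix.rank_le_width _)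

theorem ne_bot_of_mem_hermitianCodes [Fintype K] {C : Submodule K (Matrix (Fin n) (Fin n) L)} {k : ℕ}
    (hk : 1 ≤ k) (hC : C ∈ hermitianCodes K L n k) : C ≠ ⊥ := by
  rintro rfl
  have := hC.2
  rw [finrank_bot] at this
  omega

end RankMinDistance

/-! ### The Frobenius involution of a quadratic extension. -/

section FrobeniusStar

variable (K L : Type*) [Field K] [Fintype K] [Field L] [Algebra K L]

/-- The Frobenius of a quadratic extension of finite fields as a star operation. -/
abbrev frobeniusStarRing (h : Module.finrank K L = 2) : StarRing L where
  star x := x ^ Fintype.card K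
  star_involutive x := by
    have : Module.Finite K L := Module.finite_of_finrank_pos (by omega)
    have : Finite L := Module.finite_of_finite K
    have := Fintype.ofFinite L
    change (x ^ Fintype.card K) ^ Fintype.card K = x
    rw [← pow_mul, ← sq, ← h, ← Module.card_eq_pow_finrank, FiniteField.pow_card]
  star_mul x y := by
    change (x * y) ^ Fintype.card K = y ^ Fintype.card K * x ^ Fintype.card K
    rw [mul_pow, mul_comm]
  star_add x y := map_add (FiniteField.frobeniusAlgHom K L) x y

/-- X^q - X has at most q roots, and the image of `K` supplies q of them. -/
theorem natCard_pow_card_eq_self :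
    Nat.card {x : L // x ^ Fintype.card K = x} = Fintype.card K := by
  classical
  have hq : 1 < Fintype.card K := Fintype.one_lt_card
  have hp := FiniteField.X_pow_card_sub_X_ne_zero L hq
  have hiff : ∀ x : L, x ∈ (Polynomial.X ^ Fintype.card K - Polynomial.X :
      Polynomial L).roots.toFinset ↔ x ^ Fintype.card K = x := by
    intro x
    rw [Multiset.mem_toFinset, Polynomial.mem_roots hp]
    simp [sub_eq_zero]
  apply le_antisymm
  · rw [← Nat.card_congr (Equiv.subtypeEquivRight hiff), Nat.card_eq_fintype_card,
      Fintype.card_coe]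
    refine (Multiset.toFinset_card_le _).trans ((Polynomial.card_roots' _).trans ?_)
    rw [FiniteField.X_pow_card_sub_X_natDegree_eq L hq]
  · have : Finite {x : L // x ^ Fintype.card K = x} :=
      Finite.of_equiv _ (Equiv.subtypeEquivRight hiff)
    refine Nat.card_eq_fintype_card.symm.trans_le <| Nat.card_le_card_of_injective (fun a => ⟨algebraMap K L a, ?_⟩) fun a b h => ?_
    · rw [← map_pow, FiniteField.pow_card]
    · exact (algebraMap K L).injective (congrArg Subtype.val h)

end FrobeniusStar

/-! ### Explicit density bounds for fixed q. -/

section FiniteBounds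

open Module

variable (K L : Type*) [Field K] [Fintype K] [Field L] [Algebra K L]

/-- The non-zero Hermitian matrices of rank at most `r`. -/
def hermitianLowRank (n r : ℕ) : Set (hermitianSpace K L n) :=
  {M | M ≠ 0 ∧ M.1.rank ≤ r}

variable {K L}

/-- Codes are transported to subspaces of the Hermitian space, where the moment bounds apply; `hk`
excludes the zero code. -/
theorem hermitianDensity_eq (n r : ℕ) {k : ℕ} (hk : 1 ≤ k) :
    hermitianDensity K L n k (r + 1) =
      ({C : Submodule K (hermitianSpace K L n) |
        finrank K C = k ∧ ∀ M ∈ hermitianLowRank K L n r, M ∉ C}.ncard : ℝ) /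
      {C : Submodule K (hermitianSpace K L n) | finrank K C = k}.ncard := by
  have hinj : Function.Injective (Submodule.map (hermitianSpace K L n).subtype) :=
    Submodule.map_injective_of_injective (Submodule.subtype_injective _)
  have h1 : hermitianCodes K L n k = Submodule.map (hermitianSpace K L n).subtype ''
      {C : Submodule K (hermitianSpace K L n) | finrank K C = k} := by
    ext C
    constructor
    · rintro ⟨hC, hCk⟩
      refine ⟨C.comap (hermitianSpace K L n).subtype, ?_, ?_⟩
      · rw [Set.mem_ofPred_eq, ← Submodule.finrank_map_subtype_eq, Submodule.map_comap_subtype,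
          inf_eq_right.2 hC, hCk]
      · rw [Submodule.map_comap_subtype, inf_eq_right.2 hC]
    · rintro ⟨C, hC, rfl⟩
      exact ⟨Submodule.map_subtype_le _ _, (Submodule.finrank_map_subtype_eq _ _).trans hC⟩
  have h2 : {C ∈ hermitianCodes K L n k | r + 1 ≤ rankMinDistance C} =
      Submodule.map (hermitianSpace K L n).subtype ''
      {C : Submodule K (hermitianSpace K L n) |
        finrank K C = k ∧ ∀ M ∈ hermitianLowRank K L n r, M ∉ C} := by
    have h3 : ∀ C : Submodule K (hermitianSpace K L n), finrank K C = k →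
        (r + 1 ≤ rankMinDistance (C.map (hermitianSpace K L n).subtype) ↔
          ∀ M ∈ hermitianLowRank K L n r, M ∉ C) := by
      intro C hC
      have hmem : C.map (hermitianSpace K L n).subtype ∈ hermitianCodes K L n k := by
        rw [h1]
        exact ⟨C, hC, rfl⟩
      rw [le_rankMinDistance_iff (ne_bot_of_mem_hermitianCodes hk hmem)]
      constructor
      · intro h M hM hMC
        have := h M.1 ⟨M, hMC, rfl⟩ (fun h0 => hM.1 (Subtype.ext h0))
        have := hM.2
        omega
      · rintro h _ ⟨M, hMC, rfl⟩ hM0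
        by_contra hr
        exact h M ⟨fun h0 => hM0 (by rw [h0]; rfl), by simpa using hr⟩ hMC
    rw [h1]
    ext C
    constructor
    · rintro ⟨⟨C, hC, rfl⟩, hd⟩
      exact ⟨C, ⟨hC, (h3 C hC).1 hd⟩, rfl⟩
    · rintro ⟨C, ⟨hC, hd⟩, rfl⟩
      exact ⟨⟨C, hC, rfl⟩, (h3 C hC).2 hd⟩
  rw [hermitianDensity, h2, h1, Set.ncard_image_of_injective _ hinj,
    Set.ncard_image_of_injective _ hinj]

theorem smul_mem_hermitianLowRank {n r : ℕ} {a : K} (ha : a ≠ 0)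
    {M : hermitianSpace K L n} (hM : M ∈ hermitianLowRank K L n r) :
    a • M ∈ hermitianLowRank K L n r := by
  refine ⟨smul_ne_zero ha hM.1, ?_⟩
  have h : (a • M).1 = algebraMap K L a • M.1 := (algebraMap_smul L a M.1).symm
  rw [h, Matrix.rank_smul_of_mem_nonZeroDivisors]
  · exact hM.2
  · simpa using ha

variable (hKL : finrank K L = 2)
include hKL

theorem natCard_eq_card_sq : Nat.card L = Fintype.card K ^ 2 := by
  have : Module.Finite K L := Module.finite_of_finrank_pos (by omega)
  have : Finite L := Module.finite_of_finite K
  have := Fintype.ofFinite L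
  rw [Nat.card_eq_fintype_card, Module.card_eq_pow_finrank (K := K), hKL]

/-- The dimension is read off from the cardinality q^(n^2). -/
theorem finrank_hermitianSpace (n : ℕ) : finrank K (hermitianSpace K L n) = n ^ 2 := by
  have : Module.Finite K L := Module.finite_of_finrank_pos (by omega)
  have : Finite L := Module.finite_of_finite K
  have := Fintype.ofFinite (hermitianSpace K L n)
  let _ := frobeniusStarRing K L hKL
  have h := natCard_isHermitian_fin (natCard_pow_card_eq_self K L) (natCard_eq_card_sq hKL) n
  rw [Nat.card_congr (Equiv.subtypeEquivRight (p := fun M => M.IsHermitian)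
    (q := fun M => M ∈ hermitianSpace K L n) fun M => eq_comm),
    Nat.card_eq_fintype_card, Module.card_eq_pow_finrank (K := K)] at h
  exact Nat.pow_right_injective Fintype.one_lt_card h

theorem ncard_hermitianLowRank_add_one (n r : ℕ) :
    letI := frobeniusStarRing K L hKL
    (hermitianLowRank K L n r).ncard + 1 =
      Nat.card {M : Matrix (Fin n) (Fin n) L // M.IsHermitian ∧ M.rank ≤ r} := by
  have : Module.Finite K L := Module.finite_of_finrank_pos (by omega)
  have : Finite L := Module.finite_of_finite K
  let _ := frobeniusStarRing K L hKL
  have h : Nat.card {M : Matrix (Fin n) (Fin n) L // M.IsHermitian ∧ M.rank ≤ r} =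
      {M : hermitianSpace K L n | M.1.rank ≤ r}.ncard := by
    rw [← Nat.card_coe_set_eq]
    exact Nat.card_congr ((Equiv.subtypeEquivRight fun M => and_congr_left' eq_comm).trans
      (Equiv.subtypeSubtypeEquivSubtypeInter _ _).symm)
  rw [h, ← Set.ncard_insert_of_notMem (a := 0) (fun h0 => h0.1 rfl)]
  congr 1
  ext M
  by_cases hM : M = 0
  · simp [hM]
  · simp [hermitianLowRank, hM]

theorem ncard_hermitianLowRank_le (r s : ℕ) :
    (hermitianLowRank K L (r + s) r).ncard ≤
      (r + s).factorial * Fintype.card K ^ (r ^ 2 + 2 * r * s) := by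
  have : Module.Finite K L := Module.finite_of_finrank_pos (by omega)
  have : Finite L := Module.finite_of_finite K
  let _ := frobeniusStarRing K L hKL
  have h1 := ncard_hermitianLowRank_add_one hKL (r + s) r
  have h2 := natCard_isHermitian_rank_le_le (natCard_pow_card_eq_self K L)
    (natCard_eq_card_sq hKL) r s
  exact (Nat.le_succ _).trans (h1.le.trans h2)

/-- For q ≥ 4 r! at least half of the Hermitian r × r matrices are invertible; another factor 2
absorbs the removal of the zero matrix. -/
theorem le_ncard_hermitianLowRank (r s : ℕ) (hr : 1 ≤ r)
    (hq : 4 * r.factorial ≤ Fintype.card K) :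
    Fintype.card K ^ (r ^ 2 + 2 * r * s) ≤ 4 * (hermitianLowRank K L (r + s) r).ncard := by
  have : Module.Finite K L := Module.finite_of_finrank_pos (by omega)
  have : Finite L := Module.finite_of_finite K
  let _ := frobeniusStarRing K L hKL
  have h1 := ncard_hermitianLowRank_add_one hKL (r + s) r
  have h2 := le_natCard_isHermitian_rank_le (natCard_eq_card_sq hKL) r s
  rw [← h1] at h2
  obtain ⟨t, rfl⟩ := Nat.exists_eq_add_of_le' hr
  have h3 := le_natCard_isHermitian_isUnit (natCard_pow_card_eq_self K L)
    (natCard_eq_card_sq hKL) t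
  set u := Nat.card {S : Matrix (Fin (t + 1)) (Fin (t + 1)) L // S.IsHermitian ∧ IsUnit S}
  set q := Fintype.card K
  have hf := Nat.factorial_pos (t + 1)
  have h4 : q ^ (t + 1) ^ 2 = q * q ^ (t ^ 2 + 2 * t) := by ring
  have h5 : 4 * ((t + 1).factorial * q ^ (t ^ 2 + 2 * t)) ≤ q ^ (t + 1) ^ 2 := by
    rw [h4, ← mul_assoc]
    gcongr
  have h6 : q ^ (t + 1) ^ 2 ≤ 2 * u := by omega
  have h7 : q ^ ((t + 1) ^ 2 + 2 * (t + 1) * s) ≤ 2 * (u * q ^ (2 * (t + 1) * s)) := by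
    rw [pow_add, ← mul_assoc]
    gcongr
  have h8 : q ≤ q ^ ((t + 1) ^ 2 + 2 * (t + 1) * s) := Nat.le_self_pow (by positivity) _
  omega

/-- The constant is 8 = 4 · 2, from |B| ≥ q^E/4 and p ≥ q^k/(2q^N). -/
theorem hermitianDensity_le (r s : ℕ) (hr : 1 ≤ r) (hs : 1 ≤ s) {k : ℕ} (hk : 1 ≤ k)
    (hkn : k ≤ (r + s) ^ 2) (hq : 4 * r.factorial ≤ Fintype.card K) :
    hermitianDensity K L (r + s) k (r + 1) ≤
      8 * (Fintype.card K : ℝ) ^ ((((r + s) ^ 2 : ℕ) : ℤ) - k + 1 - (r ^ 2 + 2 * r * s : ℕ)) := by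
  have : Module.Finite K L := Module.finite_of_finrank_pos (by omega)
  have : Finite L := Module.finite_of_finite K
  have hB := le_ncard_hermitianLowRank hKL r s hr hq
  have hq1 : 1 < (Fintype.card K : ℝ) := by exact_mod_cast Fintype.one_lt_card
  have hV := finrank_hermitianSpace hKL (r + s)
  have hfin : (hermitianLowRank K L (r + s) r).Finite := Set.toFinite _
  rw [Set.ncard_eq_toFinset_card _ hfin] at hB
  have hB0 : hfin.toFinset.Nonempty := by
    rw [← Finset.card_pos]
    have : 0 < Fintype.card K ^ (r ^ 2 + 2 * r * s) := pow_pos Fintype.card_pos _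
    omega
  have h := ncard_submodule_disjoint_div_le (K := K) hfin.toFinset
    (by simp [hermitianLowRank]) hB0 hk (hV.symm ▸ hkn) (by rw [hV]; nlinarith)
  simp only [Set.Finite.mem_toFinset] at h
  rw [hermitianDensity_eq _ _ hk]
  refine h.trans ?_
  rw [hV]
  have hB' : (Fintype.card K : ℝ) ^ (r ^ 2 + 2 * r * s) ≤ 4 * hfin.toFinset.card := by
    exact_mod_cast hB
  set q := (Fintype.card K : ℝ)
  have hq0 : 0 < q := by linarith
  rw [zpow_sub₀ hq0.ne', zpow_add₀ hq0.ne', zpow_sub₀ hq0.ne', zpow_one, zpow_natCast,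
    zpow_natCast, zpow_natCast]
  have hq2 : 2 ≤ q := by
    have : 2 ≤ Fintype.card K := Fintype.one_lt_card
    exact Nat.ofNat_le_cast.2 this
  have hqk : q ≤ q ^ k := le_self_pow₀ hq1.le (by omega)
  have hqN : q ≤ q ^ (r + s) ^ 2 := le_self_pow₀ hq1.le (by positivity)
  have hp : q ^ k / (2 * q ^ (r + s) ^ 2) ≤ (q ^ k - 1) / (q ^ (r + s) ^ 2 - 1) := by
    rw [div_le_div_iff₀ (by linarith) (by linarith)]
    nlinarith [mul_le_mul_of_nonneg_right (hq2.trans hqk) (hq0.le.trans hqN)]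
  calc q / (hfin.toFinset.card * ((q ^ k - 1) / (q ^ (r + s) ^ 2 - 1)))
      ≤ q / (q ^ (r ^ 2 + 2 * r * s) / 4 * (q ^ k / (2 * q ^ (r + s) ^ 2))) := by
        gcongr
        linarith
    _ = _ := by
        field_simp
        norm_num

/-- Here |B| ≤ n! q^E and p ≤ q^(k-N); the 2 comes from q - 1 ≥ q/2. -/
theorem one_sub_hermitianDensity_le (r s : ℕ) (hr : 1 ≤ r) {k : ℕ} (hk : 1 ≤ k)
    (hkn : k ≤ (r + s) ^ 2) :
    1 - hermitianDensity K L (r + s) k (r + 1) ≤ 2 * (r + s).factorial *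
      (Fintype.card K : ℝ) ^ (-((((r + s) ^ 2 : ℕ) : ℤ) - k + 1 - (r ^ 2 + 2 * r * s : ℕ))) := by
  have : Module.Finite K L := Module.finite_of_finrank_pos (by omega)
  have : Finite L := Module.finite_of_finite K
  have hB := ncard_hermitianLowRank_le hKL r s
  have hq1 : 1 < (Fintype.card K : ℝ) := by exact_mod_cast Fintype.one_lt_card
  have hV := finrank_hermitianSpace hKL (r + s)
  have hfin : (hermitianLowRank K L (r + s) r).Finite := Set.toFinite _
  rw [Set.ncard_eq_toFinset_card _ hfin] at hB
  have h := one_sub_ncard_submodule_disjoint_div_le (K := K) hfin.toFinset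
    (by simp [hermitianLowRank])
    (fun a ha v hv => by simpa using smul_mem_hermitianLowRank ha (by simpa using hv))
    (hV.symm ▸ hkn) (by rw [hV]; nlinarith)
  simp only [Set.Finite.mem_toFinset] at h
  rw [hermitianDensity_eq _ _ hk]
  refine h.trans ?_
  rw [hV]
  have hB' : (hfin.toFinset.card : ℝ) ≤
      (r + s).factorial * (Fintype.card K : ℝ) ^ (r ^ 2 + 2 * r * s) := by
    exact_mod_cast hB
  set q := (Fintype.card K : ℝ)
  have hq0 : 0 < q := by linarith
  rw [zpow_neg, zpow_sub₀ hq0.ne', zpow_add₀ hq0.ne', zpow_sub₀ hq0.ne', zpow_one, zpow_natCast,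
    zpow_natCast, zpow_natCast]
  have hq2 : 2 ≤ q := by
    have : 2 ≤ Fintype.card K := Fintype.one_lt_card
    exact Nat.ofNat_le_cast.2 this
  have hqk : 1 ≤ q ^ k := one_le_pow₀ hq1.le
  have hqN : q ≤ q ^ (r + s) ^ 2 := le_self_pow₀ hq1.le (by positivity)
  have hkN : q ^ k ≤ q ^ (r + s) ^ 2 := pow_le_pow_right₀ hq1.le hkn
  have hp : (q ^ k - 1) / (q ^ (r + s) ^ 2 - 1) ≤ q ^ k / q ^ (r + s) ^ 2 := by
    rw [div_le_div_iff₀ (by linarith) (by linarith)]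
    linarith
  have hp0 : 0 ≤ (q ^ k - 1) / (q ^ (r + s) ^ 2 - 1) := div_nonneg (by linarith) (by linarith)
  calc hfin.toFinset.card * ((q ^ k - 1) / (q ^ (r + s) ^ 2 - 1)) / (q - 1)
      ≤ ((r + s).factorial * q ^ (r ^ 2 + 2 * r * s)) * (q ^ k / q ^ (r + s) ^ 2) / (q / 2) := by
        gcongr
        linarith
    _ = _ := by
        field_simp

end FiniteBounds

/-! ### Limits along the prime powers. -/

section Asymptotics

theorem tendsto_primePow_atTop :
    Tendsto (fun q : {q : ℕ // IsPrimePow q} => (q : ℕ)) atTop atTop := by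
  refine tendsto_atTop_atTop_of_monotone (fun _ _ h => h) fun N => ?_
  obtain ⟨p, hp, hprime⟩ := Nat.exists_infinite_primes N
  exact ⟨⟨p, hprime.isPrimePow⟩, hp⟩

theorem tendsto_const_mul_primePow_zpow {e : ℤ} (he : e < 0) (c : ℝ) :
    Tendsto (fun q : {q : ℕ // IsPrimePow q} => c * ((q : ℕ) : ℝ) ^ e) atTop (𝓝 0) := by
  rw [← mul_zero c]
  exact ((tendsto_zpow_atTop_zero he).comp
    (tendsto_natCast_atTop_atTop.comp tendsto_primePow_atTop)).const_mul c

end Asymptotics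

/-! ### Elementary bounds on the densities; MRD codes versus minimum distance. -/

section Density

variable {K L : Type*} [Field K] [Fintype K] [Field L] [Algebra K L]

theorem hermitianDensity_nonneg (n k d : ℕ) : 0 ≤ hermitianDensity K L n k d := by
  unfold hermitianDensity
  positivity

variable (hKL : Module.finrank K L = 2)
include hKL

theorem hermitianCodes_finite (n k : ℕ) : (hermitianCodes K L n k).Finite := by
  have : Module.Finite K L := Module.finite_of_finrank_pos (by omega)
  have : Finite L := Module.finite_of_finite K
  exact Set.toFinite _

theorem hermitianDensity_le_one (n k d : ℕ) : hermitianDensity K L n k d ≤ 1 :=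
  div_le_one_of_le₀ (Nat.cast_le.2 (Set.ncard_le_ncard (Set.sep_subset _ _)
    (hermitianCodes_finite hKL n k))) (Nat.cast_nonneg _)

theorem hermitianMRDDensity_le {n d : ℕ} (hn : 1 ≤ n) (hdn : d ≤ n) :
    hermitianMRDDensity K L n d ≤ hermitianDensity K L n (n * (n - d + 1)) d := by
  unfold hermitianMRDDensity hermitianDensity
  gcongr with C hC
  · exact (hermitianCodes_finite hKL n _).subset (Set.sep_subset _ _)
  · rintro ⟨-, hbot, hdim⟩
    have h1 := rankMinDistance_le hbot
    -- As both d and the minimum distance are at most n, the truncated subtractions are exact and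
    -- the two agree.
    have h2 : n - d + 1 = n - rankMinDistance C + 1 :=
      Nat.eq_of_mul_eq_mul_left hn (hC.2.symm.trans hdim)
    omega

omit hKL in
theorem hermitianMRDDensity_nonneg (n d : ℕ) : 0 ≤ hermitianMRDDensity K L n d := by
  unfold hermitianMRDDensity
  positivity

end Density

theorem theorem6p15
    (K L : {q : ℕ // IsPrimePow q} → Type*)
    [∀ q, Field (K q)] [∀ q, Fintype (K q)] [∀ q, Field (L q)] [∀ q, Algebra (K q) (L q)]
    (hK : ∀ q, Fintype.card (K q) = (q : ℕ))
    (hL : ∀ q, Module.finrank (K q) (L q) = 2)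
    (n d : ℕ) (hd : 2 ≤ d) (hdn : d ≤ n) :
    (∀ k : ℕ, 1 ≤ k → k ≤ n * (n - d + 1) →
      ((fun q => hermitianDensity (K q) (L q) n k d) =O[atTop]
        (fun q => ((q : ℕ) : ℝ) ^
          ((n : ℤ) ^ 2 - k + 1 - ((d : ℤ) - 1) * (2 * n - d + 1)))) ∧
      ((k : ℤ) < (n : ℤ) ^ 2 + 1 - ((d : ℤ) - 1) * (2 * n - d + 1) →
        Tendsto (fun q => hermitianDensity (K q) (L q) n k d) atTop (𝓝 1)) ∧
      ((n : ℤ) ^ 2 + 1 - ((d : ℤ) - 1) * (2 * n - d + 1) < (k : ℤ) →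
        Tendsto (fun q => hermitianDensity (K q) (L q) n k d) atTop (𝓝 0))) ∧
    ((fun q => hermitianDensity (K q) (L q) n (n * (n - d + 1)) d) =O[atTop]
      (fun q => ((q : ℕ) : ℝ) ^ (-((d : ℤ) - 1) * (n - d + 1) + 1))) ∧
    (3 ≤ n → Tendsto (fun q => hermitianMRDDensity (K q) (L q) n d) atTop (𝓝 0)) := by
  have hupper : ∀ k : ℕ, 1 ≤ k → k ≤ n * (n - d + 1) →
      ∀ᶠ q : {q : ℕ // IsPrimePow q} in atTop, hermitianDensity (K q) (L q) n k d ≤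
        8 * ((q : ℕ) : ℝ) ^ ((n : ℤ) ^ 2 - k + 1 - ((d : ℤ) - 1) * (2 * n - d + 1)) := by
    intro k hk hkn
    obtain ⟨r, rfl⟩ : ∃ r, d = r + 1 := ⟨d - 1, by omega⟩
    obtain ⟨s, rfl⟩ : ∃ s, n = r + s := ⟨n - r, by omega⟩
    filter_upwards [tendsto_primePow_atTop.eventually_ge_atTop (4 * r.factorial)] with q hq
    have h := hermitianDensity_le (hL q) r s (by omega) (by omega) hk
      (hkn.trans (by rw [sq]; exact Nat.mul_le_mul_left _ (by omega))) (by rw [hK q]; exact hq)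
    rw [hK q] at h
    convert h using 3
    push_cast
    ring
  have hlower : ∀ k : ℕ, 1 ≤ k → k ≤ n * (n - d + 1) → ∀ q : {q : ℕ // IsPrimePow q},
      1 - hermitianDensity (K q) (L q) n k d ≤ 2 * n.factorial *
        ((q : ℕ) : ℝ) ^ (-((n : ℤ) ^ 2 - k + 1 - ((d : ℤ) - 1) * (2 * n - d + 1))) := by
    intro k hk hkn q
    obtain ⟨r, rfl⟩ : ∃ r, d = r + 1 := ⟨d - 1, by omega⟩
    obtain ⟨s, rfl⟩ : ∃ s, n = r + s := ⟨n - r, by omega⟩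
    have h := one_sub_hermitianDensity_le (hL q) r s (by omega) hk
      (hkn.trans (by rw [sq]; exact Nat.mul_le_mul_left _ (by omega)))
    rw [hK q] at h
    convert h using 4
    push_cast
    ring
  have hO : ∀ k : ℕ, 1 ≤ k → k ≤ n * (n - d + 1) →
      (fun q => hermitianDensity (K q) (L q) n k d) =O[atTop]
        (fun q => ((q : ℕ) : ℝ) ^
          ((n : ℤ) ^ 2 - k + 1 - ((d : ℤ) - 1) * (2 * n - d + 1))) := by
    intro k hk hkn
    refine IsBigO.of_bound 8 ?_
    filter_upwards [hupper k hk hkn] with q hq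
    rw [Real.norm_of_nonneg (hermitianDensity_nonneg n k d), Real.norm_of_nonneg (by positivity)]
    exact hq
  have h0 : ∀ k : ℕ, 1 ≤ k → k ≤ n * (n - d + 1) →
      (n : ℤ) ^ 2 + 1 - ((d : ℤ) - 1) * (2 * n - d + 1) < (k : ℤ) →
      Tendsto (fun q => hermitianDensity (K q) (L q) n k d) atTop (𝓝 0) := by
    intro k hk hkn hlt
    exact tendsto_of_tendsto_of_tendsto_of_le_of_le' tendsto_const_nhds
      (tendsto_const_mul_primePow_zpow (by linarith) 8)
      (Eventually.of_forall fun q => hermitianDensity_nonneg n k d) (hupper k hk hkn)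
  have hk1 : 1 ≤ n * (n - d + 1) := Nat.mul_pos (by omega) (by omega)
  have hkcast : ((n * (n - d + 1) : ℕ) : ℤ) = n * (n - d + 1) := by
    push_cast [Nat.cast_sub hdn]
    ring
  refine ⟨fun k hk hkn => ⟨hO k hk hkn, fun hlt => ?_, h0 k hk hkn⟩, ?_, fun hn => ?_⟩
  -- Below the threshold the exponent bounding the complementary density is negative.
  · have h := tendsto_const_mul_primePow_zpow
      (e := -((n : ℤ) ^ 2 - k + 1 - ((d : ℤ) - 1) * (2 * n - d + 1))) (by linarith)
      (2 * n.factorial)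
    have h' := squeeze_zero (fun q => sub_nonneg.2 (hermitianDensity_le_one (hL q) n k d))
      (hlower k hk hkn) h
    simpa using h'.const_sub 1
  · convert hO _ hk1 le_rfl using 3
    rw [hkcast]
    ring
  · refine squeeze_zero (fun q => hermitianMRDDensity_nonneg n d)
      (fun q => hermitianMRDDensity_le (hL q) (by omega) hdn) (h0 _ hk1 le_rfl ?_)
    rw [hkcast]
    zify at hd hdn hn
    -- The claim is (d-1)(n-d+1) > 1, and the left side equals (d-2)(n-d) + n - 1 ≥ 2.
    nlinarith [mul_nonneg (sub_nonneg.2 hd) (sub_nonneg.2 hdn)]
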